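/- Let $\mathbb{N}$ be the state space. A Markov chain $X_1,X_2,\ldots$ on $\mathbb{N}$ with transition kernel $A=(A(y\mid x))_{x,y\in\mathbb{N}}$ and stationary distribution $\pi$ (so $\sum_x A(y\mid x)\pi_x=\pi_y$ for all $y$) is called $(G,\theta)$-geometrically ergodic, where $1\le G<\infty$ and $0\le\theta<1$, if $$\sup_{x\in\mathbb{N}}\tfrac12\sum_{y\in\mathbb{N}}\bigl|\mathbb{P}(X_s=y\mid X_1=x)-\pi_y\bigr|\le G\theta^{s-1},\qquad s=1,2,\ldots,$$ where $\mathbb{P}(X_s=\cdot\mid X_1=x)$ is the $(s-1)$-step transition probability from $x$. A hidden Markov chain $Y_1,Y_2,\ldots$ with initial distribution $p$, transition kernel $A$ and emission kernel $B$ is a sequence of $\mathbb{N}$-valued random variables such that for all $n\ge1$ and $y\in\mathbb{N}^n$ $$\mathbb{P}(Y_1=y_1,\ldots,Y_n=y_n)=\sum_{x\in\mathbb{N}^n}p(x_1)\prod_{i=1}^{n-1}A(x_{i+1}\mid x_i)\prod_{i=1}^{n}B(y_i\mid x_i).$$ It is called stationary if $p=\pi$, its stationary distribution is $\rho=B\pi$,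 i.e. $\rho_y=\sum_x B(y\mid x)\pi_x$, and it is called $(G,\theta)$-geometrically ergodic if $A$ (the kernel of the underlying Markov chain) is. For $1\le G<\infty$, $0\le\theta<1$, $n\ge 1$ and a probability distribution $\rho$ on $\mathbb{N}$ define $$\gamma_n(G,\theta)=\frac12\sqrt{\frac{1+2G\theta}{n(1-\theta)}},$$ $$\Lambda_n(\rho)=\gamma_n(G,\theta)\sum_{y:\rho_y\ge1/n}\sqrt{\rho_y}+\min\Bigl\{\gamma_n(G,\theta)\sum_{y:\rho_y<1/n}\sqrt{\rho_y}\,,\ \sum_{y:\rho_y<1/n}\rho_y\Bigr\},$$ where the first sum inside the minimum may be $+\infty$. Then: (a) For every probability distribution $\rho$ on $\mathbb{N}$, $\lim_{n\to\infty}\Lambda_n(\rho)=0$. (b) Let $Y_1,Y_2,\ldots$ be a stationary $(G,\theta)$-geometrically ergodic Markov chain (with stationary distribution $\rho=\pi$) or hidden Markov chain (with stationary distribution $\rho=B\pi$), and let $$\hat\rho^{(n)}(E)=\frac1n\sum_{i=1}^n\mathbf{1}[Y_i\in E],\qquad E\subseteq\mathbb{N}.$$ Then for all $n\ge1$ and all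 $\varepsilon>0$, $$\mathbb{P}\Bigl(\sup_{E\subseteq\mathbb{N}}\bigl|\rho(E)-\hat\rho^{(n)}(E)\bigr|>\Lambda_n(\rho)+\varepsilon\Bigr)\le\exp\Bigl(-\frac{n(1-\theta)^2\varepsilon^2}{2G^2}\Bigr).$$ -/

import Mathlib

open Filter Topology MeasureTheory
open scoped ENNReal

noncomputable section

namespace UniformChernoff

/-- Total variation distance `½ ∑ y, |p y - q y|` of two distributions on `ℕ`
(the series always converges). -/
def tvDist (p q : PMF ℕ) : ℝ :=
  (1 / 2) * ∑' y : ℕ, |(p y).toReal - (q y).toReal|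

/-- `stepLaw A s x` is the law of `X_s` given `X_1 = x`, for `s = 1, 2, …`, of a Markov chain
whose transition kernel is `A`. A kernel (column-stochastic matrix) is a map `A : ℕ → PMF ℕ`,
with `A x y` the probability `A(y | x)`; the product of the matrix `A` and the vector `p` is
`p.bind A`. -/
def stepLaw (A : ℕ → PMF ℕ) (s : ℕ) (x : ℕ) : PMF ℕ :=
  (fun p : PMF ℕ => p.bind A)^[s - 1] (PMF.pure x)

/-- `τ_s = sup_x ‖L(X_s | X_1 = x) - π‖_TV` (a supremum of numbers in `[0, 1]`). -/
def inverseMixingTime (A : ℕ → PMF ℕ) (π : PMF ℕ) (s : ℕ) : ℝ :=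
  ⨆ x : ℕ, tvDist (stepLaw A s x) π

/-- The kernel `A` has stationary distribution `π` and is geometrically ergodic with
constants `1 ≤ G < ∞` and `0 ≤ θ < 1`. -/
structure GeometricallyErgodic (A : ℕ → PMF ℕ) (π : PMF ℕ) (G θ : ℝ) : Prop where
  one_le_G : 1 ≤ G
  theta_nonneg : 0 ≤ θ
  theta_lt_one : θ < 1
  stationary : π.bind A = π
  mixing : ∀ s : ℕ, 1 ≤ s → inverseMixingTime A π s ≤ G * θ ^ (s - 1)

/-- The probability `p(x_1) ∏ A(x_{i+1} | x_i)` of a path of `n + 1` states under the Markov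
chain with initial distribution `p` and kernel `A`. -/
def pathProb (p : PMF ℕ) (A : ℕ → PMF ℕ) {n : ℕ} (x : Fin (n + 1) → ℕ) : ℝ≥0∞ :=
  p (x 0) * ∏ i : Fin n, A (x i.castSucc) (x i.succ)

/-- The probability of `n + 1` observations under the hidden Markov chain with parameters
`(p, A, B)`: the sum over all hidden paths `x` of `P(X = x) ∏ B(y_i | x_i)`. -/
def obsProb (p : PMF ℕ) (A B : ℕ → PMF ℕ) {n : ℕ} (y : Fin (n + 1) → ℕ) : ℝ≥0∞ :=
  ∑' x : Fin (n + 1) → ℕ, pathProb p A x * ∏ i : Fin (n + 1), B (x i) (y i)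

/-- `X 0, X 1, …` (that is, `X_1, X_2, …`) is a Markov chain with parameters `(p, A)`. -/
structure IsMarkovChain {Ω : Type*} [MeasurableSpace Ω] (P : Measure Ω) (X : ℕ → Ω → ℕ)
    (p : PMF ℕ) (A : ℕ → PMF ℕ) : Prop where
  measurable : ∀ i, Measurable (X i)
  law : ∀ (n : ℕ) (x : Fin (n + 1) → ℕ),
    P {ω | ∀ i : Fin (n + 1), X i ω = x i} = pathProb p A x

/-- `Y 0, Y 1, …` (that is, `Y_1, Y_2, …`) is a hidden Markov chain with parameters
`(p, A, B)`. -/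
structure IsHiddenMarkovChain {Ω : Type*} [MeasurableSpace Ω] (P : Measure Ω) (Y : ℕ → Ω → ℕ)
    (p : PMF ℕ) (A B : ℕ → PMF ℕ) : Prop where
  measurable : ∀ i, Measurable (Y i)
  law : ∀ (n : ℕ) (y : Fin (n + 1) → ℕ),
    P {ω | ∀ i : Fin (n + 1), Y i ω = y i} = obsProb p A B y

/-- The occupation frequency of `E` among the first `n` variables. -/
def occupationFreq {Ω : Type*} (Y : ℕ → Ω → ℕ) (n : ℕ) (ω : Ω) (E : Set ℕ) : ℝ :=
  (1 / (n : ℝ)) * ∑ i ∈ Finset.range n, E.indicator (fun _ => (1 : ℝ)) (Y i ω)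

/-- `sup_E |ρ(E) - ρ̂⁽ⁿ⁾(E)|`, over all sets `E` of natural numbers. -/
def uniformDeviation {Ω : Type*} (ρ : PMF ℕ) (Y : ℕ → Ω → ℕ) (n : ℕ) (ω : Ω) : ℝ≥0∞ :=
  ⨆ E : Set ℕ, ENNReal.ofReal |ρ.toMeasure.real E - occupationFreq Y n ω E|

/-- `γ_n(G, θ) = ½ √((1 + 2Gθ) / (n (1 - θ)))`. -/
def gammaCoeff (G θ : ℝ) (n : ℕ) : ℝ :=
  (1 / 2) * √((1 + 2 * G * θ) / (n * (1 - θ)))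

/-- `Λ_n(ρ)`, with values in `[0, ∞]` because the sum of `√ρ_y` over the `y` with `ρ_y < 1/n`
may diverge. -/
def Lam (G θ : ℝ) (n : ℕ) (ρ : PMF ℕ) : ℝ≥0∞ :=
  ENNReal.ofReal (gammaCoeff G θ n) *
      ∑' y : {y : ℕ // 1 / (n : ℝ≥0∞) ≤ ρ y}, (ρ y) ^ (1 / 2 : ℝ) +
    min
      (ENNReal.ofReal (gammaCoeff G θ n) *
        ∑' y : {y : ℕ // ρ y < 1 / (n : ℝ≥0∞)}, (ρ y) ^ (1 / 2 : ℝ))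
      (∑' y : {y : ℕ // ρ y < 1 / (n : ℝ≥0∞)}, ρ y)

end UniformChernoff

end

noncomputable section

namespace UniformChernoff

section

variable {α β : Type*}

/-- The expectation of a real function under a discrete distribution. -/
def expect (p : PMF α) (f : α → ℝ) : ℝ := ∑' a, (p a).toReal * f a

/-- A real function with bounded absolute value. -/
def IsBdd (f : α → ℝ) : Prop := ∃ C, ∀ a, |f a| ≤ C

lemma IsBdd.of_mem_Icc {f : α → ℝ} {m M : ℝ} (h : ∀ a, f a ∈ Set.Icc m M) : IsBdd f :=
  ⟨max |m| |M|, fun a => abs_le_max_abs_abs (h a).1 (h a).2⟩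

lemma isBdd_const (c : ℝ) : IsBdd (fun _ : α => c) := ⟨|c|, fun _ => le_rfl⟩

lemma IsBdd.comp {f : β → ℝ} (hf : IsBdd f) (g : α → β) : IsBdd (fun a => f (g a)) :=
  ⟨hf.choose, fun _ => hf.choose_spec _⟩

lemma IsBdd.add {f g : α → ℝ} (hf : IsBdd f) (hg : IsBdd g) : IsBdd (fun a => f a + g a) := by
  obtain ⟨C, hC⟩ := hf
  obtain ⟨D, hD⟩ := hg
  exact ⟨C + D, fun a => (abs_add_le _ _).trans (add_le_add (hC a) (hD a))⟩

lemma IsBdd.neg {f : α → ℝ} (hf : IsBdd f) : IsBdd (fun a => - f a) := by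
  obtain ⟨C, hC⟩ := hf
  exact ⟨C, fun a => by simpa using hC a⟩

lemma IsBdd.sub {f g : α → ℝ} (hf : IsBdd f) (hg : IsBdd g) : IsBdd (fun a => f a - g a) := by
  simpa [sub_eq_add_neg] using hf.add hg.neg

lemma IsBdd.mul {f g : α → ℝ} (hf : IsBdd f) (hg : IsBdd g) : IsBdd (fun a => f a * g a) := by
  obtain ⟨C, hC⟩ := hf
  obtain ⟨D, hD⟩ := hg
  exact ⟨C * D, fun a => by
    rw [abs_mul]
    exact mul_le_mul (hC a) (hD a) (abs_nonneg _) ((abs_nonneg _).trans (hC a))⟩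

lemma IsBdd.abs {f : α → ℝ} (hf : IsBdd f) : IsBdd (fun a => |f a|) := by
  obtain ⟨C, hC⟩ := hf
  exact ⟨C, fun a => by simpa using hC a⟩

lemma IsBdd.exp {f : α → ℝ} (hf : IsBdd f) : IsBdd (fun a => Real.exp (f a)) := by
  obtain ⟨C, hC⟩ := hf
  exact ⟨Real.exp C, fun a => by
    rw [abs_of_pos (Real.exp_pos _)]
    exact Real.exp_le_exp.2 ((le_abs_self _).trans (hC a))⟩

lemma isBdd_sum {ι : Type*} (s : Finset ι) {f : ι → α → ℝ} (hf : ∀ i, IsBdd (f i)) :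
    IsBdd (fun a => ∑ i ∈ s, f i a) := by
  classical
  induction s using Finset.induction_on with
  | empty => simpa using isBdd_const (α := α) 0
  | insert i s hi ih => simpa [Finset.sum_insert hi] using (hf i).add ih

lemma hasSum_toReal (p : PMF α) : HasSum (fun a => (p a).toReal) 1 := by
  have h := ENNReal.hasSum_toReal (f := p) (by simp [p.tsum_coe])
  rwa [← ENNReal.tsum_toReal_eq (fun a => p.apply_ne_top a), p.tsum_coe, ENNReal.toReal_one] at h

lemma summable_expect (p : PMF α) {f : α → ℝ} (hf : IsBdd f) :
    Summable (fun a => (p a).toReal * f a) := by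
  obtain ⟨C, hC⟩ := hf
  refine Summable.of_norm_bounded ((hasSum_toReal p).summable.mul_right C) fun a => ?_
  rw [Real.norm_eq_abs, abs_mul, abs_of_nonneg ENNReal.toReal_nonneg]
  exact mul_le_mul_of_nonneg_left (hC a) ENNReal.toReal_nonneg

lemma expect_const (p : PMF α) (c : ℝ) : expect p (fun _ => c) = c := by
  simp [expect, tsum_mul_right, (hasSum_toReal p).tsum_eq]

lemma expect_add (p : PMF α) {f g : α → ℝ} (hf : IsBdd f) (hg : IsBdd g) :
    expect p (fun a => f a + g a) = expect p f + expect p g := by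
  simp only [expect, mul_add]
  exact (summable_expect p hf).tsum_add (summable_expect p hg)

lemma expect_sub (p : PMF α) {f g : α → ℝ} (hf : IsBdd f) (hg : IsBdd g) :
    expect p (fun a => f a - g a) = expect p f - expect p g := by
  simp only [expect, mul_sub]
  exact (summable_expect p hf).tsum_sub (summable_expect p hg)

lemma expect_const_mul (p : PMF α) (c : ℝ) (f : α → ℝ) :
    expect p (fun a => c * f a) = c * expect p f := by
  simp only [expect, ← tsum_mul_left]
  exact tsum_congr fun a => by ring

lemma expect_mul_const (p : PMF α) (c : ℝ) (f : α → ℝ) :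
    expect p (fun a => f a * c) = expect p f * c := by
  simp only [expect, ← tsum_mul_right]
  exact tsum_congr fun a => by ring

lemma expect_mono (p : PMF α) {f g : α → ℝ} (hf : IsBdd f) (hg : IsBdd g)
    (h : ∀ a, f a ≤ g a) : expect p f ≤ expect p g :=
  (summable_expect p hf).tsum_le_tsum
    (fun a => mul_le_mul_of_nonneg_left (h a) ENNReal.toReal_nonneg) (summable_expect p hg)

lemma expect_mem_Icc (p : PMF α) {f : α → ℝ} {m M : ℝ} (h : ∀ a, f a ∈ Set.Icc m M) :
    expect p f ∈ Set.Icc m M := by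
  have hf : IsBdd f := .of_mem_Icc h
  constructor
  · simpa [expect_const] using expect_mono p (isBdd_const m) hf fun a => (h a).1
  · simpa [expect_const] using expect_mono p hf (isBdd_const M) fun a => (h a).2

lemma IsBdd.expect {f : α → β → ℝ} (hf : IsBdd (fun z : α × β => f z.1 z.2))
    (p : α → PMF β) : IsBdd (fun a => UniformChernoff.expect (p a) (f a)) := by
  obtain ⟨C, hC⟩ := hf
  exact .of_mem_Icc (m := -C) (M := C) fun a =>
    expect_mem_Icc (p a) fun b => abs_le.1 (hC (a, b))

lemma expect_pure (a : α) (f : α → ℝ) : expect (PMF.pure a) f = f a := by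
  rw [expect, tsum_eq_single a]
  · simp
  · intro b hb
    simp [hb]

lemma expect_bind (p : PMF α) (q : α → PMF β) {f : β → ℝ} (hf : IsBdd f) :
    expect (p.bind q) f = expect p (fun a => expect (q a) f) := by
  have e : ∀ b, ((p.bind q) b).toReal * f b =
      ∑' a, (p a).toReal * ((q a b).toReal * f b) := by
    intro b
    rw [PMF.bind_apply, ENNReal.tsum_toReal_eq
      (fun a => ENNReal.mul_ne_top (p.apply_ne_top a) ((q a).apply_ne_top b)), ← tsum_mul_right]
    exact tsum_congr fun a => by rw [ENNReal.toReal_mul, mul_assoc]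
  have hs : Summable (fun z : α × β => (p z.1).toReal * ((q z.1 z.2).toReal * f z.2)) := by
    obtain ⟨C, hC⟩ := hf
    have h0 : Summable (fun z : α × β => (p z.1).toReal * (q z.1 z.2).toReal) := by
      have hn : 0 ≤ fun z : α × β => (p z.1).toReal * (q z.1 z.2).toReal := fun z =>
        mul_nonneg ENNReal.toReal_nonneg ENNReal.toReal_nonneg
      have h1 : ∀ a, HasSum (fun b => (p a).toReal * (q a b).toReal) ((p a).toReal) := fun a => by
        simpa using (hasSum_toReal (q a)).mul_left (p a).toReal
      rw [summable_prod_of_nonneg hn]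
      refine ⟨fun a => (h1 a).summable, ?_⟩
      simp only [(h1 _).tsum_eq]
      exact (hasSum_toReal p).summable
    refine Summable.of_norm_bounded (h0.mul_right C) fun z => ?_
    rw [← mul_assoc, Real.norm_eq_abs, abs_mul,
      abs_of_nonneg (mul_nonneg ENNReal.toReal_nonneg ENNReal.toReal_nonneg)]
    exact mul_le_mul_of_nonneg_left (hC _)
      (mul_nonneg ENNReal.toReal_nonneg ENNReal.toReal_nonneg)
  simp only [expect, e, ← tsum_mul_left]
  exact (Summable.tsum_comm (f := fun a b => (p a).toReal * ((q a b).toReal * f b)) hs)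

lemma expect_map (p : PMF α) (g : α → β) {f : β → ℝ} (hf : IsBdd f) :
    expect (p.map g) f = expect p (fun a => f (g a)) := by
  rw [PMF.map, expect_bind p _ hf]
  simp [expect_pure]

lemma sq_expect_le (p : PMF α) {f : α → ℝ} (hf : IsBdd f) :
    expect p f ^ 2 ≤ expect p (fun a => f a ^ 2) := by
  set m := expect p f with hm
  have hf2 : IsBdd (fun a => f a ^ 2) := by simpa [sq] using hf.mul hf
  have hl : IsBdd (fun a => 2 * m * f a - m ^ 2) :=
    ((isBdd_const (2 * m)).mul hf).sub (isBdd_const _)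
  have h := expect_mono p hl hf2 fun a => by nlinarith [sq_nonneg (f a - m)]
  rw [expect_sub p ((isBdd_const (2 * m)).mul hf) (isBdd_const _), expect_const_mul,
    expect_const, ← hm] at h
  linarith

lemma ofReal_expect (p : PMF α) {f : α → ℝ} (hf : IsBdd f) (h0 : ∀ a, 0 ≤ f a) :
    ENNReal.ofReal (expect p f) = ∑' a, p a * ENNReal.ofReal (f a) := by
  rw [expect, ENNReal.ofReal_tsum_of_nonneg
    (fun a => mul_nonneg ENNReal.toReal_nonneg (h0 a)) (summable_expect p hf)]
  refine tsum_congr fun a => ?_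
  rw [ENNReal.ofReal_mul ENNReal.toReal_nonneg, ENNReal.ofReal_toReal (p.apply_ne_top a)]

/-- A function with oscillation at most `c` integrates against a summable signed mass function
of total mass zero to at most `c / 2` times its `ℓ¹` norm. -/
lemma tsum_mul_le_of_tsum_eq_zero {u w : ℕ → ℝ} (hu : Summable u) (h0 : ∑' a, u a = 0)
    {m c : ℝ} (hw : ∀ a, w a ∈ Set.Icc m (m + c)) :
    ∑' a, u a * w a ≤ c * ((1 / 2) * ∑' a, |u a|) := by
  obtain ⟨C, hC⟩ := IsBdd.of_mem_Icc hw
  have hs : Summable (fun a => u a * w a) := by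
    refine Summable.of_norm_bounded (hu.abs.mul_right C) fun a => ?_
    rw [Real.norm_eq_abs, abs_mul]
    exact mul_le_mul_of_nonneg_left (hC a) (abs_nonneg _)
  have e : ∑' a, u a * w a = ∑' a, (u a * w a - u a * (m + c / 2)) := by
    rw [hs.tsum_sub (hu.mul_right _), tsum_mul_right, h0, zero_mul, sub_zero]
  rw [e, ← mul_assoc, ← tsum_mul_left]
  refine (hs.sub (hu.mul_right _)).tsum_le_tsum (fun a => ?_) (hu.abs.mul_left _)
  have h1 : |w a - (m + c / 2)| ≤ c * (1 / 2) := by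
    rw [abs_le]
    constructor <;> linarith [(hw a).1, (hw a).2]
  calc u a * w a - u a * (m + c / 2) = u a * (w a - (m + c / 2)) := by ring
    _ ≤ |u a| * |w a - (m + c / 2)| := by rw [← abs_mul]; exact le_abs_self _
    _ ≤ |u a| * (c * (1 / 2)) := mul_le_mul_of_nonneg_left h1 (abs_nonneg _)
    _ = c * (1 / 2) * |u a| := by ring

lemma expect_sub_expect_le (p q : PMF ℕ) {w : ℕ → ℝ} {m c : ℝ}
    (hw : ∀ a, w a ∈ Set.Icc m (m + c)) :
    expect p w - expect q w ≤ c * tvDist p q := by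
  have hb := IsBdd.of_mem_Icc hw
  have hp := hasSum_toReal p
  have hq := hasSum_toReal q
  have h := tsum_mul_le_of_tsum_eq_zero (u := fun a => (p a).toReal - (q a).toReal)
    (hp.summable.sub hq.summable)
    (by rw [hp.summable.tsum_sub hq.summable, hp.tsum_eq, hq.tsum_eq, sub_self]) hw
  rw [expect, expect, ← (summable_expect p hb).tsum_sub (summable_expect q hb)]
  simpa [sub_mul, tvDist] using h

lemma summable_tvDist (p q : PMF ℕ) : Summable (fun a => |(p a).toReal - (q a).toReal|) :=
  ((hasSum_toReal p).summable.sub (hasSum_toReal q).summable).abs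

lemma tvDist_le_one (p q : PMF ℕ) : tvDist p q ≤ 1 := by
  have hp := hasSum_toReal p
  have hq := hasSum_toReal q
  have h : ∑' a, |(p a).toReal - (q a).toReal| ≤ ∑' a, ((p a).toReal + (q a).toReal) :=
    (summable_tvDist p q).tsum_le_tsum (fun a => (abs_sub _ _).trans_eq (by simp))
      (hp.summable.add hq.summable)
  rw [hp.summable.tsum_add hq.summable, hp.tsum_eq, hq.tsum_eq] at h
  rw [tvDist]
  linarith

lemma tvDist_triangle (p q r : PMF ℕ) : tvDist p q ≤ tvDist p r + tvDist q r := by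
  rw [tvDist, tvDist, tvDist, ← mul_add, ← (summable_tvDist p r).tsum_add (summable_tvDist q r)]
  refine mul_le_mul_of_nonneg_left ?_ (by norm_num)
  refine (summable_tvDist p q).tsum_le_tsum (fun a => ?_)
    ((summable_tvDist p r).add (summable_tvDist q r))
  rw [abs_sub_comm (q a).toReal]
  exact abs_sub_le _ _ _

lemma GeometricallyErgodic.tvDist_le {A : ℕ → PMF ℕ} {π : PMF ℕ} {G θ : ℝ}
    (h : GeometricallyErgodic A π G θ) (x j : ℕ) :
    tvDist ((fun p : PMF ℕ => p.bind A)^[j] (A x)) π ≤ G * θ ^ (j + 1) := by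
  have h1 := h.mixing (j + 2) (by omega)
  have h2 := le_ciSup (f := fun x => tvDist (stepLaw A (j + 2) x) π)
    ⟨1, by rintro _ ⟨y, rfl⟩; exact tvDist_le_one _ _⟩ x
  have e : stepLaw A (j + 2) x = (fun p : PMF ℕ => p.bind A)^[j] (A x) := by
    simp [stepLaw]
  rw [← e]
  exact h2.trans h1

end

section

variable {α β : Type*}

lemma expect_eq_integral [MeasurableSpace α] [DiscreteMeasurableSpace α] (p : PMF α)
    {f : α → ℝ} (hf : IsBdd f) : expect p f = ∫ a, f a ∂p.toMeasure := by
  obtain ⟨C, hC⟩ := hf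
  have hm : Measurable f := Measurable.of_discrete
  have hi : Integrable f p.toMeasure := by
    refine Integrable.of_bound (hm.aestronglyMeasurable) C (ae_of_all _ fun a => hC a)
  rw [PMF.integral_eq_tsum p f hi]
  simp [expect]

/-- Hoeffding's lemma for discrete distributions. -/
lemma expect_exp_sub_expect_le [MeasurableSpace α] [DiscreteMeasurableSpace α] (p : PMF α)
    {V : α → ℝ} {m D : ℝ} (hV : ∀ a, V a ∈ Set.Icc m (m + D)) (t : ℝ) :
    expect p (fun a => Real.exp (t * (V a - expect p V))) ≤
      Real.exp ((D / 2) ^ 2 * t ^ 2 / 2) := by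
  have hb : IsBdd V := .of_mem_Icc hV
  have h := (ProbabilityTheory.hasSubgaussianMGF_of_mem_Icc (μ := p.toMeasure) (X := V)
    (Measurable.of_discrete).aemeasurable (ae_of_all _ hV)).mgf_le t
  have he : IsBdd (fun a => Real.exp (t * (V a - expect p V))) :=
    ((isBdd_const t).mul (hb.sub (isBdd_const _))).exp
  rw [expect_eq_integral p he]
  rw [ProbabilityTheory.mgf, ← expect_eq_integral p hb] at h
  refine h.trans_eq ?_
  congr 1
  simp [div_pow]

/-- The law of the first `n` observations of a hidden Markov chain with initial distribution
`μ`, transition kernel `A` and emission kernel `B`. -/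
def obsLaw (A B : ℕ → PMF ℕ) : (n : ℕ) → PMF ℕ → PMF (Fin n → ℕ)
  | 0, _ => PMF.pure Fin.elim0
  | n + 1, μ => μ.bind fun x => (B x).bind fun y => (obsLaw A B n (A x)).map (Fin.cons y)

/-- `f` changes by at most `c` when one of its arguments is changed. -/
def HasBddDiff {n : ℕ} (c : ℝ) (f : (Fin n → ℕ) → ℝ) : Prop :=
  ∀ y i a, f y ≤ f (Function.update y i a) + c

section

variable (A B : ℕ → PMF ℕ)

lemma expect_obsLaw_zero (μ : PMF ℕ) (f : (Fin 0 → ℕ) → ℝ) :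
    expect (obsLaw A B 0 μ) f = f Fin.elim0 := expect_pure _ _

lemma isBdd_expect_cons {n : ℕ} {f : (Fin (n + 1) → ℕ) → ℝ} (hf : IsBdd f)
    (q : ℕ × ℕ → PMF (Fin n → ℕ)) :
    IsBdd (fun z : ℕ × ℕ => expect (q z) fun v => f (Fin.cons z.2 v)) :=
  IsBdd.expect (f := fun (z : ℕ × ℕ) v => f (Fin.cons z.2 v))
    (hf.comp fun w : (ℕ × ℕ) × (Fin n → ℕ) => Fin.cons w.1.2 w.2) q

lemma expect_obsLaw_succ {n : ℕ} (μ : PMF ℕ) {f : (Fin (n + 1) → ℕ) → ℝ} (hf : IsBdd f) :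
    expect (obsLaw A B (n + 1) μ) f = expect μ fun x => expect (B x) fun y =>
      expect (obsLaw A B n (A x)) fun z => f (Fin.cons y z) := by
  rw [obsLaw, expect_bind _ _ hf]
  congr 1
  funext x
  rw [expect_bind _ _ hf]
  congr 1
  funext y
  rw [expect_map _ _ hf]

/-- The law of the first state together with the first observation. -/
def firstLaw (μ : PMF ℕ) : PMF (ℕ × ℕ) := μ.bind fun x => (B x).map (Prod.mk x)

lemma expect_firstLaw (μ : PMF ℕ) {f : ℕ × ℕ → ℝ} (hf : IsBdd f) :
    expect (firstLaw B μ) f = expect μ fun x => expect (B x) fun y => f (x, y) := by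
  rw [firstLaw, expect_bind _ _ hf]
  congr 1
  funext x
  rw [expect_map _ _ hf]

lemma expect_obsLaw_succ' {n : ℕ} (μ : PMF ℕ) {f : (Fin (n + 1) → ℕ) → ℝ} (hf : IsBdd f) :
    expect (obsLaw A B (n + 1) μ) f = expect (firstLaw B μ) fun z =>
      expect (obsLaw A B n (A z.1)) fun v => f (Fin.cons z.2 v) := by
  rw [expect_obsLaw_succ A B μ hf, expect_firstLaw B μ (isBdd_expect_cons hf _)]

lemma bind_obsLaw (n : ℕ) (μ : PMF ℕ) :
    (μ.bind fun x => obsLaw A B n (A x)) = obsLaw A B n (μ.bind A) := by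
  cases n <;> simp [obsLaw]

lemma expect_obsLaw_bind {n : ℕ} (μ : PMF ℕ) {f : (Fin n → ℕ) → ℝ} (hf : IsBdd f) :
    (expect μ fun x => expect (obsLaw A B n (A x)) f) = expect (obsLaw A B n (μ.bind A)) f := by
  rw [← bind_obsLaw, expect_bind _ _ hf]

variable {A B}

lemma HasBddDiff.cons {n : ℕ} {c : ℝ} {f : (Fin (n + 1) → ℕ) → ℝ} (hf : HasBddDiff c f)
    (a : ℕ) : HasBddDiff c fun z : Fin n → ℕ => f (Fin.cons a z) := by
  intro y i b
  simpa [Fin.cons_update] using hf (Fin.cons a y) i.succ b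

lemma HasBddDiff.cons_le {n : ℕ} {c : ℝ} {f : (Fin (n + 1) → ℕ) → ℝ} (hf : HasBddDiff c f)
    (a b : ℕ) (z : Fin n → ℕ) : f (Fin.cons a z) ≤ f (Fin.cons b z) + c := by
  simpa [Fin.update_cons_zero] using hf (Fin.cons a z) 0 b

lemma expect_obsLaw_sub_le {c : ℝ} {n : ℕ} {g : (Fin n → ℕ) → ℝ} (hb : IsBdd g)
    (hg : HasBddDiff c g) (μ ν : PMF ℕ) :
    expect (obsLaw A B n μ) g - expect (obsLaw A B n ν) g ≤
      c * ∑ j ∈ Finset.range n, tvDist ((fun p : PMF ℕ => p.bind A)^[j] μ)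
        ((fun p : PMF ℕ => p.bind A)^[j] ν) := by
  induction n generalizing μ ν with
  | zero => simp [expect_obsLaw_zero]
  | succ n ih =>
    obtain ⟨C, hC⟩ := hb
    have hb : IsBdd g := ⟨C, hC⟩
    set g' : (Fin n → ℕ) → ℝ := fun z => ⨅ a : ℕ, g (Fin.cons a z) with hg'
    have hbelow : ∀ z : Fin n → ℕ, BddBelow (Set.range fun a : ℕ => g (Fin.cons a z)) :=
      fun z => ⟨-C, by rintro _ ⟨a, rfl⟩; exact (abs_le.1 (hC _)).1⟩
    have hle : ∀ z a, g' z ≤ g (Fin.cons a z) := fun z a => ciInf_le (hbelow z) a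
    have hge : ∀ z a, g (Fin.cons a z) ≤ g' z + c := fun z a => by
      have : g (Fin.cons a z) - c ≤ g' z := le_ciInf fun b => by
        linarith [hg.cons_le a b z]
      linarith
    have hb' : IsBdd g' := .of_mem_Icc (m := -C) (M := C) fun z =>
      ⟨le_ciInf fun a => (abs_le.1 (hC _)).1, (hle z 0).trans (abs_le.1 (hC _)).2⟩
    have hd' : HasBddDiff c g' := fun z i b => by
      have : g' z - c ≤ g' (Function.update z i b) := le_ciInf fun a => by
        linarith [hg.cons a z i b, hle z a]
      linarith
    have hbd : IsBdd fun y : Fin (n + 1) → ℕ => g y - g' (Fin.tail y) := hb.sub (hb'.comp _)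
    have hbt : IsBdd fun y : Fin (n + 1) → ℕ => g' (Fin.tail y) := hb'.comp _
    set w : ℕ → ℝ := fun x => expect (B x) fun y => expect (obsLaw A B n (A x)) fun z =>
      g (Fin.cons y z) - g' z with hw
    have hwI : ∀ x, w x ∈ Set.Icc 0 (0 + c) := fun x =>
      expect_mem_Icc _ fun y => expect_mem_Icc _ fun z =>
        ⟨by linarith [hle z y], by linarith [hge z y]⟩
    have split : ∀ μ : PMF ℕ, expect (obsLaw A B (n + 1) μ) g =
        expect μ w + expect (obsLaw A B n (μ.bind A)) g' := by
      intro μ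
      have h1 := expect_obsLaw_succ A B μ hbd
      have h2 := expect_obsLaw_succ A B μ hbt
      rw [expect_sub _ hb hbt] at h1
      simp only [Fin.tail_cons, expect_const] at h1 h2
      rw [expect_obsLaw_bind A B μ hb'] at h2
      rw [← h2]
      change _ = expect μ w at h1
      linarith
    rw [split, split, Finset.sum_range_succ']
    have h1 := ih hb' hd' (μ.bind A) (ν.bind A)
    have h2 := expect_sub_expect_le μ ν hwI
    simp only [Function.iterate_succ_apply, Function.iterate_zero, id_eq, mul_add]
    linarith

/-- The bounded-difference moment bound: if conditional expectations given the state at some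
time vary by at most `D` (including the change of the current observation), the centred
function is sub-Gaussian. -/
lemma expect_exp_obsLaw_le {c R : ℝ} (hR : ∀ (n : ℕ) (g : (Fin n → ℕ) → ℝ), IsBdd g →
      HasBddDiff c g → ∀ x x', expect (obsLaw A B n (A x)) g ≤ expect (obsLaw A B n (A x')) g + R)
    (t : ℝ) {n : ℕ} {f : (Fin n → ℕ) → ℝ} (hb : IsBdd f) (hf : HasBddDiff c f) (μ : PMF ℕ) :
    expect (obsLaw A B n μ) (fun y => Real.exp (t * (f y - expect (obsLaw A B n μ) f))) ≤
      Real.exp (n * (((c + R) / 2) ^ 2 * t ^ 2 / 2)) := by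
  induction n generalizing μ with
  | zero => simp [expect_obsLaw_zero]
  | succ n ih =>
    set V : ℕ × ℕ → ℝ := fun z => expect (obsLaw A B n (A z.1)) fun v => f (Fin.cons z.2 v)
      with hV
    set m := expect (obsLaw A B (n + 1) μ) f with hm
    have hVb : IsBdd V := isBdd_expect_cons hb _
    have hmV : m = expect (firstLaw B μ) V := expect_obsLaw_succ' A B μ hb
    have hbe : ∀ s, IsBdd (fun y => Real.exp (t * (f y - s))) := fun s =>
      ((isBdd_const t).mul (hb.sub (isBdd_const _))).exp
    have hVe : IsBdd fun z => Real.exp (t * (V z - m)) :=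
      ((isBdd_const t).mul (hVb.sub (isBdd_const _))).exp
    have hosc : ∀ z z', V z ≤ V z' + (c + R) := fun z z' => by
      have h1 := hR n _ (hb.comp (Fin.cons z.2)) (hf.cons z.2) z.1 z'.1
      have h2 := expect_mono (obsLaw A B n (A z'.1)) (hb.comp (Fin.cons z.2))
        ((hb.comp (Fin.cons z'.2)).add (isBdd_const c)) fun v => hf.cons_le z.2 z'.2 v
      rw [expect_add _ (hb.comp (Fin.cons z'.2)) (isBdd_const c), expect_const] at h2
      simp only [hV]
      linarith
    have hVI : ∀ z, V z ∈ Set.Icc (⨅ z, V z) ((⨅ z, V z) + (c + R)) := fun z => by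
      obtain ⟨C, hC⟩ := hVb
      refine ⟨ciInf_le ⟨-C, by rintro _ ⟨a, rfl⟩; exact (abs_le.1 (hC _)).1⟩ z, ?_⟩
      have : V z - (c + R) ≤ ⨅ z, V z := le_ciInf fun z' => by linarith [hosc z z']
      linarith
    rw [expect_obsLaw_succ' A B μ (hbe m)]
    have hstep : ∀ z : ℕ × ℕ, (expect (obsLaw A B n (A z.1)) fun v =>
        Real.exp (t * (f (Fin.cons z.2 v) - m))) ≤
        Real.exp (t * (V z - m)) * Real.exp (n * (((c + R) / 2) ^ 2 * t ^ 2 / 2)) := fun z => by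
      have h := ih (hb.comp (Fin.cons z.2)) (hf.cons z.2) (A z.1)
      refine le_trans (le_of_eq ?_) (mul_le_mul_of_nonneg_left h (Real.exp_pos _).le)
      rw [← expect_const_mul]
      congr 1
      funext v
      rw [← Real.exp_add]
      congr 1
      simp only [hV]
      ring
    refine (expect_mono _ (isBdd_expect_cons (hbe m) _) (hVe.mul (isBdd_const _)) hstep).trans ?_
    rw [expect_mul_const]
    have h := expect_exp_sub_expect_le (firstLaw B μ) hVI t
    rw [← hmV] at h
    refine (mul_le_mul_of_nonneg_right h (Real.exp_pos _).le).trans_eq ?_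
    rw [← Real.exp_add]
    congr 1
    push_cast
    ring

end

end

section

variable {A B : ℕ → PMF ℕ} {π : PMF ℕ} {G θ : ℝ}

lemma isBdd_sum_apply {n : ℕ} {h : ℕ → ℝ} (hh : IsBdd h) :
    IsBdd fun y : Fin n → ℕ => ∑ i, h (y i) :=
  isBdd_sum Finset.univ fun i => hh.comp fun y : Fin n → ℕ => y i

lemma expect_obsLaw_sum {h : ℕ → ℝ} (hh : IsBdd h) (n : ℕ) (μ : PMF ℕ) :
    (expect (obsLaw A B n μ) fun y => ∑ i, h (y i)) =
      ∑ j ∈ Finset.range n, expect ((fun p : PMF ℕ => p.bind A)^[j] μ)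
        fun x => expect (B x) h := by
  induction n generalizing μ with
  | zero => simp [expect_obsLaw_zero]
  | succ n ih =>
    have hB : IsBdd fun x => expect (B x) h :=
      IsBdd.expect (f := fun (_ : ℕ) b => h b) (hh.comp Prod.snd) B
    have hS := isBdd_sum_apply (n := n) hh
    have hM : IsBdd fun x => expect (obsLaw A B n (A x)) fun z => ∑ i, h (z i) :=
      IsBdd.expect (f := fun (_ : ℕ) (z : Fin n → ℕ) => ∑ i, h (z i)) (hS.comp Prod.snd) _
    rw [expect_obsLaw_succ A B μ (isBdd_sum_apply hh), Finset.sum_range_succ']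
    simp only [Fin.sum_univ_succ, Fin.cons_zero, Fin.cons_succ, Function.iterate_succ_apply,
      Function.iterate_zero, id_eq]
    rw [← ih (μ.bind A), ← expect_obsLaw_bind A B μ hS, add_comm, ← expect_add μ hB hM]
    congr 1
    funext x
    rw [← expect_const (B x) (expect (obsLaw A B n (A x)) _), ← expect_add _ hh (isBdd_const _)]
    congr 1
    funext y
    rw [expect_add _ (isBdd_const _) hS, expect_const]

lemma iterate_bind_of_stationary (h : π.bind A = π) (j : ℕ) :
    (fun p : PMF ℕ => p.bind A)^[j] π = π :=
  Function.iterate_fixed h j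

lemma expect_obsLaw_sum_of_stationary (hs : π.bind A = π) {h : ℕ → ℝ} (hh : IsBdd h) (n : ℕ) :
    (expect (obsLaw A B n π) fun y => ∑ i, h (y i)) = n * expect (π.bind B) h := by
  rw [expect_obsLaw_sum hh]
  simp [iterate_bind_of_stationary hs, expect_bind _ _ hh]

lemma sum_range_pow_succ_le (hθ0 : 0 ≤ θ) (hθ1 : θ < 1) (n : ℕ) :
    ∑ j ∈ Finset.range n, θ ^ (j + 1) ≤ θ / (1 - θ) := by
  have h := (summable_geometric_of_lt_one hθ0 hθ1).sum_le_tsum (Finset.range n)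
    fun j _ => pow_nonneg hθ0 j
  rw [tsum_geometric_of_lt_one hθ0 hθ1] at h
  simp only [pow_succ]
  rw [← Finset.sum_mul, div_eq_inv_mul]
  exact mul_le_mul_of_nonneg_right h hθ0

lemma expect_obsLaw_sum_le (hA : GeometricallyErgodic A π G θ) {h : ℕ → ℝ} {m : ℝ}
    (hh : ∀ b, h b ∈ Set.Icc m (m + 1)) (h0 : expect (π.bind B) h = 0) (n x : ℕ) :
    (expect (obsLaw A B n (A x)) fun y => ∑ i, h (y i)) ≤ G * (θ / (1 - θ)) := by
  have hb : IsBdd h := .of_mem_Icc hh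
  rw [expect_obsLaw_sum hb]
  refine le_trans (Finset.sum_le_sum fun j _ => ?_) (le_trans (Finset.mul_sum _ _ _).ge
    (mul_le_mul_of_nonneg_left (sum_range_pow_succ_le hA.theta_nonneg hA.theta_lt_one n)
      (zero_le_one.trans hA.one_le_G)))
  have h1 := expect_sub_expect_le ((fun p : PMF ℕ => p.bind A)^[j] (A x)) π
    (w := fun x => expect (B x) h) fun x => expect_mem_Icc (B x) hh
  rw [← expect_bind _ _ hb, ← expect_bind _ _ hb, h0, expect_bind _ _ hb] at h1
  linarith [hA.tvDist_le x j]

/-- The indicator of a point. -/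
def pointInd (a b : ℕ) : ℝ := if b = a then 1 else 0

lemma pointInd_mem (a b : ℕ) : pointInd a b ∈ Set.Icc (0 : ℝ) 1 := by
  unfold pointInd
  split_ifs <;> simp

lemma isBdd_pointInd (a : ℕ) : IsBdd (pointInd a) := .of_mem_Icc (pointInd_mem a)

lemma expect_pointInd (p : PMF ℕ) (a : ℕ) : expect p (pointInd a) = (p a).toReal := by
  rw [expect, tsum_eq_single a]
  · simp [pointInd]
  · intro b hb
    simp [pointInd, hb]

/-- The second moment of the centred number of visits to `a`. -/
lemma expect_obsLaw_sq_le (hA : GeometricallyErgodic A π G θ) (a n : ℕ) :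
    (expect (obsLaw A B n π) fun y => (∑ i, (pointInd a (y i) - ((π.bind B) a).toReal)) ^ 2) ≤
      n * (((π.bind B) a).toReal * (1 + 2 * (G * (θ / (1 - θ))))) := by
  set r := ((π.bind B) a).toReal with hr
  set K := G * (θ / (1 - θ)) with hK
  set h : ℕ → ℝ := fun b => pointInd a b - r with hh
  have hI := isBdd_pointInd a
  have hb : IsBdd h := hI.sub (isBdd_const _)
  have hmem : ∀ b, h b ∈ Set.Icc (-r) (-r + 1) := fun b => by
    have := pointInd_mem a b
    exact ⟨by simp only [hh]; linarith [this.1], by simp only [hh]; linarith [this.2]⟩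
  have h0 : expect (π.bind B) h = 0 := by
    simp only [hh]
    rw [expect_sub _ hI (isBdd_const _), expect_pointInd, expect_const, sub_self]
  induction n with
  | zero => simp [expect_obsLaw_zero]
  | succ n ih =>
    have hS : IsBdd fun z : Fin n → ℕ => ∑ i, h (z i) := isBdd_sum_apply hb
    have hS2 : IsBdd fun z : Fin n → ℕ => (∑ i, h (z i)) ^ 2 := by simpa [sq] using hS.mul hS
    have hS' : IsBdd fun z : Fin (n + 1) → ℕ => (∑ i, h (z i)) ^ 2 := by
      simpa [sq] using (isBdd_sum_apply (n := n + 1) hb).mul (isBdd_sum_apply hb)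
    set M : ℕ → ℝ := fun x => expect (obsLaw A B n (A x)) fun z => ∑ i, h (z i) with hM
    set Q : ℕ → ℝ := fun x => expect (obsLaw A B n (A x)) fun z => (∑ i, h (z i)) ^ 2 with hQ
    have hMb : IsBdd M :=
      IsBdd.expect (f := fun (_ : ℕ) (z : Fin n → ℕ) => ∑ i, h (z i)) (hS.comp Prod.snd) _
    have hQb : IsBdd Q :=
      IsBdd.expect (f := fun (_ : ℕ) (z : Fin n → ℕ) => (∑ i, h (z i)) ^ 2) (hS2.comp Prod.snd) _
    have hMK : ∀ x, M x ≤ K := fun x => expect_obsLaw_sum_le hA hmem h0 n x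
    have hM0 : expect π M = 0 := by
      rw [hM, expect_obsLaw_bind A B π hS, hA.stationary,
        expect_obsLaw_sum_of_stationary hA.stationary hb, h0, mul_zero]
    have hQπ : expect π Q = expect (obsLaw A B n π) fun z => (∑ i, h (z i)) ^ 2 := by
      rw [hQ, expect_obsLaw_bind A B π hS2, hA.stationary]
    have inner : ∀ x y, (expect (obsLaw A B n (A x)) fun z =>
        (∑ i, h ((Fin.cons y z : Fin (n + 1) → ℕ) i)) ^ 2) ≤
          pointInd a y * (1 - 2 * r + 2 * K) + (r ^ 2 - 2 * r * M x + Q x) := by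
      intro x y
      have e : (fun z : Fin n → ℕ => (∑ i, h ((Fin.cons y z : Fin (n + 1) → ℕ) i)) ^ 2) =
          fun z => h y ^ 2 + (2 * h y * (∑ i, h (z i)) + (∑ i, h (z i)) ^ 2) := by
        funext z
        simp only [Fin.sum_univ_succ, Fin.cons_zero, Fin.cons_succ]
        ring
      rw [e, expect_add _ (isBdd_const _) (((isBdd_const _).mul hS).add hS2), expect_const,
        expect_add _ ((isBdd_const _).mul hS) hS2, expect_const_mul]
      change h y ^ 2 + (2 * h y * M x + Q x) ≤ _
      have h1 := hMK x
      by_cases hya : y = a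
      · simp only [hh, pointInd, hya, if_true]
        nlinarith
      · simp only [hh, pointInd, hya, if_false]
        nlinarith
    rw [expect_obsLaw_succ A B π hS']
    have hN : IsBdd fun x => r ^ 2 - 2 * r * M x + Q x :=
      ((isBdd_const _).sub ((isBdd_const _).mul hMb)).add hQb
    have hIK : IsBdd fun y => pointInd a y * (1 - 2 * r + 2 * K) := hI.mul (isBdd_const _)
    have hIB : IsBdd fun x => expect (B x) fun y => pointInd a y * (1 - 2 * r + 2 * K) :=
      IsBdd.expect (f := fun (_ : ℕ) y => pointInd a y * (1 - 2 * r + 2 * K))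
        (hIK.comp Prod.snd) B
    have hcons : IsBdd fun z : ℕ × ℕ => expect (obsLaw A B n (A z.1)) fun v =>
        (∑ i, h ((Fin.cons z.2 v : Fin (n + 1) → ℕ) i)) ^ 2 := isBdd_expect_cons hS' _
    have h1 : ∀ x, (expect (B x) fun y => expect (obsLaw A B n (A x)) fun z =>
        (∑ i, h ((Fin.cons y z : Fin (n + 1) → ℕ) i)) ^ 2) ≤
        (expect (B x) fun y => pointInd a y * (1 - 2 * r + 2 * K)) +
          (r ^ 2 - 2 * r * M x + Q x) := fun x => by
      refine (expect_mono (B x) (hcons.comp fun y => (x, y)) (hIK.add (isBdd_const _))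
        (inner x)).trans_eq ?_
      rw [expect_add _ hIK (isBdd_const _), expect_const]
    refine (expect_mono π (IsBdd.expect (f := fun x y => expect (obsLaw A B n (A x)) fun z =>
      (∑ i, h ((Fin.cons y z : Fin (n + 1) → ℕ) i)) ^ 2) hcons B) (hIB.add hN) h1).trans ?_
    rw [expect_add _ hIB hN, ← expect_bind π B hIK, expect_mul_const, expect_pointInd,
      expect_add _ ((isBdd_const _).sub ((isBdd_const _).mul hMb)) hQb,
      expect_sub _ (isBdd_const _) ((isBdd_const _).mul hMb), expect_const, expect_const_mul,
      hM0, hQπ, ← hr]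
    push_cast
    have hr0 : 0 ≤ r := ENNReal.toReal_nonneg
    nlinarith [sq_nonneg r]

/-- The frequency of `a` among the entries of `y`. -/
def freq {n : ℕ} (y : Fin n → ℕ) (a : ℕ) : ℝ := (1 / (n : ℝ)) * ∑ i, pointInd a (y i)

lemma isBdd_freq (n a : ℕ) : IsBdd fun y : Fin n → ℕ => freq y a :=
  (isBdd_const _).mul (isBdd_sum_apply (isBdd_pointInd a))

lemma freq_nonneg {n : ℕ} (y : Fin n → ℕ) (a : ℕ) : 0 ≤ freq y a :=
  mul_nonneg (by positivity) (Finset.sum_nonneg fun i _ => (pointInd_mem a (y i)).1)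

lemma expect_abs_sub_freq_le_mass (hs : π.bind A = π) {n : ℕ} (hn : 1 ≤ n) (a : ℕ) :
    (expect (obsLaw A B n π) fun y => 1 / 2 * |((π.bind B) a).toReal - freq y a|) ≤
      ((π.bind B) a).toReal := by
  set r := ((π.bind B) a).toReal with hr
  have hr0 : 0 ≤ r := ENNReal.toReal_nonneg
  have hf := isBdd_freq n a
  have hn' : (n : ℝ) ≠ 0 := by positivity
  refine (expect_mono _ ((isBdd_const _).mul ((isBdd_const _).sub hf).abs)
    ((isBdd_const (1 / 2)).mul ((isBdd_const r).add hf)) fun y => ?_).trans_eq ?_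
  · refine mul_le_mul_of_nonneg_left ?_ (by norm_num)
    have := freq_nonneg y a
    rw [abs_le]
    constructor <;> linarith
  · rw [expect_const_mul, expect_add _ (isBdd_const r) hf, expect_const]
    simp only [freq]
    rw [expect_const_mul, expect_obsLaw_sum_of_stationary hs (isBdd_pointInd a), expect_pointInd,
      ← hr]
    field_simp
    ring

lemma expect_abs_sub_freq_le_sqrt (hA : GeometricallyErgodic A π G θ) {n : ℕ} (hn : 1 ≤ n)
    (a : ℕ) :
    (expect (obsLaw A B n π) fun y => 1 / 2 * |((π.bind B) a).toReal - freq y a|) ≤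
      gammaCoeff G θ n * √((π.bind B) a).toReal := by
  set r := ((π.bind B) a).toReal with hr
  have hr0 : 0 ≤ r := ENNReal.toReal_nonneg
  have hf := isBdd_freq n a
  have hn' : (0 : ℝ) < n := by positivity
  have hθ : 0 < 1 - θ := sub_pos.2 hA.theta_lt_one
  have hθ0 := hA.theta_nonneg
  have hG : 0 ≤ G := zero_le_one.trans hA.one_le_G
  have h1 := sq_expect_le (obsLaw A B n π) ((isBdd_const r).sub hf).abs
  have e : ∀ y : Fin n → ℕ, |r - freq y a| ^ 2 =
      (1 / (n : ℝ)) ^ 2 * (∑ i, (pointInd a (y i) - r)) ^ 2 := fun y => by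
    rw [sq_abs, Finset.sum_sub_distrib, freq, ← mul_pow]
    simp only [Finset.sum_const, Finset.card_univ, Fintype.card_fin, nsmul_eq_mul]
    field_simp
    ring
  simp only [e] at h1
  rw [expect_const_mul] at h1
  have h2 := mul_le_mul_of_nonneg_left (expect_obsLaw_sq_le (B := B) hA a n)
    (sq_nonneg (1 / (n : ℝ)))
  have h3 : (1 / (n : ℝ)) ^ 2 * (n * (r * (1 + 2 * (G * (θ / (1 - θ)))))) ≤
      (1 + 2 * G * θ) / (n * (1 - θ)) * r := by
    have : (1 / (n : ℝ)) ^ 2 * (n * (r * (1 + 2 * (G * (θ / (1 - θ)))))) =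
        (1 - θ + 2 * G * θ) / (n * (1 - θ)) * r := by
      field_simp
    rw [this]
    gcongr
    linarith
  rw [expect_const_mul, gammaCoeff, mul_assoc, ← Real.sqrt_mul (by positivity)]
  refine mul_le_mul_of_nonneg_left (Real.le_sqrt_of_sq_le ?_) (by norm_num)
  exact h1.trans (h2.trans h3)

/-- The uniform deviation of the empirical measure of `y` from `ρ`. -/
def empDeviation {n : ℕ} (ρ : PMF ℕ) (y : Fin n → ℕ) : ℝ≥0∞ :=
  ⨆ E : Set ℕ, ENNReal.ofReal
    |ρ.toMeasure.real E - (1 / (n : ℝ)) * ∑ i, E.indicator (fun _ => (1 : ℝ)) (y i)|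

lemma uniformDeviation_eq {Ω : Type*} (ρ : PMF ℕ) (Y : ℕ → Ω → ℕ) (n : ℕ) (ω : Ω) :
    uniformDeviation ρ Y n ω = empDeviation ρ fun i : Fin n => Y i ω := by
  simp only [uniformDeviation, empDeviation, occupationFreq, Finset.sum_range]

lemma indicator_one_mem {α : Type*} (E : Set α) (a : α) :
    E.indicator (fun _ => (1 : ℝ)) a ∈ Set.Icc (0 : ℝ) 1 := by
  by_cases h : a ∈ E <;> simp [h]

lemma avg_indicator_mem {n : ℕ} (E : Set ℕ) (y : Fin n → ℕ) :
    (1 / (n : ℝ)) * ∑ i, E.indicator (fun _ => (1 : ℝ)) (y i) ∈ Set.Icc (0 : ℝ) 1 := by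
  refine ⟨mul_nonneg (by positivity) (Finset.sum_nonneg fun i _ => (indicator_one_mem E _).1), ?_⟩
  have h : ∑ i, E.indicator (fun _ => (1 : ℝ)) (y i) ≤ n := by
    simpa using Finset.sum_le_sum fun i (_ : i ∈ Finset.univ) => (indicator_one_mem E (y i)).2
  rw [one_div, ← div_eq_inv_mul]
  exact div_le_one_of_le₀ h (by positivity)

lemma empDeviation_le_one {n : ℕ} (ρ : PMF ℕ) (y : Fin n → ℕ) : empDeviation ρ y ≤ 1 := by
  refine iSup_le fun E => ?_
  rw [← ENNReal.ofReal_one]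
  refine ENNReal.ofReal_le_ofReal ?_
  have h1 := avg_indicator_mem E y
  have h2 : ρ.toMeasure.real E ≤ 1 := measureReal_le_one
  have h3 : 0 ≤ ρ.toMeasure.real E := measureReal_nonneg
  rw [abs_le]
  constructor <;> linarith [h1.1, h1.2]

lemma empDeviation_update_le {n : ℕ} (ρ : PMF ℕ) (y : Fin n → ℕ) (i : Fin n) (a : ℕ) :
    empDeviation ρ y ≤ empDeviation ρ (Function.update y i a) + ENNReal.ofReal (1 / n) := by
  refine iSup_le fun E => ?_
  set s : (Fin n → ℕ) → ℝ := fun y => ∑ j, E.indicator (fun _ => (1 : ℝ)) (y j) with hs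
  have hd : |s (Function.update y i a) - s y| ≤ 1 := by
    have h1 := Finset.add_sum_erase Finset.univ (fun j => E.indicator (fun _ => (1 : ℝ)) (y j))
      (Finset.mem_univ i)
    have h2 := Finset.add_sum_erase Finset.univ
      (fun j => E.indicator (fun _ => (1 : ℝ)) (Function.update y i a j)) (Finset.mem_univ i)
    have h3 : ∑ j ∈ Finset.univ.erase i,
        E.indicator (fun _ => (1 : ℝ)) (Function.update y i a j) =
        ∑ j ∈ Finset.univ.erase i, E.indicator (fun _ => (1 : ℝ)) (y j) :=
      Finset.sum_congr rfl fun j hj => by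
        rw [Function.update_of_ne (Finset.ne_of_mem_erase hj)]
    simp only [Function.update_self] at h2
    rw [h3] at h2
    have m1 := indicator_one_mem E a
    have m2 := indicator_one_mem E (y i)
    simp only [hs]
    rw [← h1, ← h2, abs_le]
    constructor <;> linarith [m1.1, m1.2, m2.1, m2.2]
  refine le_trans ?_ (add_le_add_left (le_iSup (fun E : Set ℕ => ENNReal.ofReal
    |ρ.toMeasure.real E - (1 / (n : ℝ)) *
      ∑ j, E.indicator (fun _ => (1 : ℝ)) (Function.update y i a j)|) E) _)
  rw [← ENNReal.ofReal_add (abs_nonneg _) (by positivity)]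
  refine ENNReal.ofReal_le_ofReal ?_
  change |ρ.toMeasure.real E - 1 / (n : ℝ) * s y| ≤
    |ρ.toMeasure.real E - 1 / (n : ℝ) * s (Function.update y i a)| + 1 / n
  have h4 : |1 / (n : ℝ) * s (Function.update y i a) - 1 / (n : ℝ) * s y| ≤ 1 / n := by
    rw [← mul_sub, abs_mul, abs_of_nonneg (by positivity : (0 : ℝ) ≤ 1 / n)]
    exact mul_le_of_le_one_right (by positivity) hd
  exact (abs_sub_le _ _ _).trans (add_le_add_right h4 _)

lemma empDeviation_ne_top {n : ℕ} (ρ : PMF ℕ) (y : Fin n → ℕ) : empDeviation ρ y ≠ ⊤ :=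
  ne_top_of_le_ne_top ENNReal.one_ne_top (empDeviation_le_one ρ y)

lemma isBdd_empDeviation (n : ℕ) (ρ : PMF ℕ) :
    IsBdd fun y : Fin n → ℕ => (empDeviation ρ y).toReal :=
  .of_mem_Icc (m := 0) (M := 1) fun y => ⟨ENNReal.toReal_nonneg,
    ENNReal.toReal_le_of_le_ofReal zero_le_one (by simpa using empDeviation_le_one ρ y)⟩

lemma hasBddDiff_empDeviation (n : ℕ) (ρ : PMF ℕ) :
    HasBddDiff (1 / n) fun y : Fin n → ℕ => (empDeviation ρ y).toReal := fun y i a => by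
  have h := ENNReal.toReal_mono
    (ENNReal.add_ne_top.2 ⟨empDeviation_ne_top ρ _, ENNReal.ofReal_ne_top⟩)
    (empDeviation_update_le ρ y i a)
  rwa [ENNReal.toReal_add (empDeviation_ne_top ρ _) ENNReal.ofReal_ne_top,
    ENNReal.toReal_ofReal (by positivity)] at h

lemma hasSum_freq_mul {n : ℕ} (y : Fin n → ℕ) (w : ℕ → ℝ) :
    HasSum (fun a => freq y a * w a) ((1 / (n : ℝ)) * ∑ i, w (y i)) := by
  have h : HasSum (fun a => ∑ i, pointInd a (y i) * w a) (∑ i, w (y i)) := by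
    refine hasSum_sum fun i _ => ?_
    convert hasSum_single (f := fun a => pointInd a (y i) * w a) (y i) ?_ using 1
    · simp [pointInd]
    · intro a ha
      simp [pointInd, ha.symm]
  have e : (fun a => freq y a * w a) = fun a => 1 / (n : ℝ) * ∑ i, pointInd a (y i) * w a := by
    funext a
    rw [freq, ← Finset.sum_mul, mul_assoc]
  rw [e]
  exact h.mul_left _

lemma toMeasure_real_eq_expect {α : Type*} [MeasurableSpace α] [DiscreteMeasurableSpace α]
    (p : PMF α) (E : Set α) : p.toMeasure.real E = expect p (E.indicator fun _ => 1) := by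
  have h := integral_indicator_one (μ := p.toMeasure) (MeasurableSet.of_discrete (s := E))
  rw [← h, expect_eq_integral p (.of_mem_Icc (indicator_one_mem E))]
  rfl

lemma empDeviation_le_tsum {n : ℕ} (hn : 1 ≤ n) (ρ : PMF ℕ) (y : Fin n → ℕ) :
    empDeviation ρ y ≤ ∑' a, ENNReal.ofReal (1 / 2 * |(ρ a).toReal - freq y a|) := by
  have hρ := hasSum_toReal ρ
  have hn' : (n : ℝ) ≠ 0 := by positivity
  have hq : HasSum (fun a => freq y a) 1 := by
    simpa [hn'] using hasSum_freq_mul y fun _ => 1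
  have hu := hρ.sub hq
  rw [sub_self] at hu
  rw [← ENNReal.ofReal_tsum_of_nonneg (fun a => by positivity) (hu.summable.abs.mul_left _),
    tsum_mul_left]
  refine iSup_le fun E => ENNReal.ofReal_le_ofReal ?_
  have hw := indicator_one_mem E
  have hE := (summable_expect ρ (.of_mem_Icc hw)).hasSum.sub 
    (hasSum_freq_mul y (E.indicator fun _ => (1 : ℝ)))
  rw [toMeasure_real_eq_expect, expect, ← hE.tsum_eq, abs_le]
  have h1 := tsum_mul_le_of_tsum_eq_zero hu.summable hu.tsum_eq (m := 0) (c := 1)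
    (w := E.indicator fun _ => (1 : ℝ)) (by simpa using hw)
  have h2 := tsum_mul_le_of_tsum_eq_zero hu.summable hu.tsum_eq (m := -1) (c := 1)
    (w := fun a => - E.indicator (fun _ => (1 : ℝ)) a) fun a => by
      constructor <;> linarith [(hw a).1, (hw a).2]
  simp only [mul_neg, tsum_neg, sub_mul, one_mul] at h1 h2
  exact ⟨by linarith, h1⟩

lemma tsum_subtype_le_add_tsum_subtype_lt (ρ f : ℕ → ℝ≥0∞) (c : ℝ≥0∞) :
    ∑' a : {a // c ≤ ρ a}, f a + ∑' a : {a // ρ a < c}, f a = ∑' a, f a := by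
  have hc : ({a | c ≤ ρ a}ᶜ : Set ℕ) = {a | ρ a < c} := by
    ext a
    simp
  have h := Summable.tsum_add_tsum_compl (f := f) (s := {a | c ≤ ρ a})
    ENNReal.summable ENNReal.summable
  rw [hc] at h
  exact h

lemma tsum_ofReal_le_Lam {n : ℕ} {ρ : PMF ℕ} {t : ℕ → ℝ} (hm : ∀ a, t a ≤ (ρ a).toReal)
    (hg : ∀ a, t a ≤ gammaCoeff G θ n * √(ρ a).toReal) :
    ∑' a, ENNReal.ofReal (t a) ≤ Lam G θ n ρ := by
  have hm' : ∀ a, ENNReal.ofReal (t a) ≤ ρ a := fun a => ENNReal.ofReal_le_of_le_toReal (hm a)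
  have hg' : ∀ a, ENNReal.ofReal (t a) ≤
      ENNReal.ofReal (gammaCoeff G θ n) * (ρ a) ^ (1 / 2 : ℝ) := fun a => by
    refine (ENNReal.ofReal_le_ofReal (hg a)).trans_eq ?_
    rw [ENNReal.ofReal_mul (by unfold gammaCoeff; positivity), Real.sqrt_eq_rpow,
      ENNReal.toReal_rpow, ENNReal.ofReal_toReal
        (ENNReal.rpow_ne_top_of_nonneg (by norm_num) (ρ.apply_ne_top a))]
  rw [← tsum_subtype_le_add_tsum_subtype_lt ρ _ (1 / n), Lam]
  refine add_le_add ?_ (le_min ?_ ?_)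
  · rw [← ENNReal.tsum_mul_left]
    exact ENNReal.tsum_le_tsum fun a => hg' a
  · rw [← ENNReal.tsum_mul_left]
    exact ENNReal.tsum_le_tsum fun a => hg' a
  · exact ENNReal.tsum_le_tsum fun a => hm' a

/-- The expected uniform deviation is at most `Λ_n(ρ)`. -/
lemma ofReal_expect_empDeviation_le (hA : GeometricallyErgodic A π G θ) {n : ℕ} (hn : 1 ≤ n) :
    ENNReal.ofReal (expect (obsLaw A B n π) fun y => (empDeviation (π.bind B) y).toReal) ≤
      Lam G θ n (π.bind B) := by
  have e : ∀ a, ENNReal.ofReal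
      (expect (obsLaw A B n π) fun y => 1 / 2 * |((π.bind B) a).toReal - freq y a|) =
      ∑' y, obsLaw A B n π y *
        ENNReal.ofReal (1 / 2 * |((π.bind B) a).toReal - freq y a|) := fun a =>
    ofReal_expect _ ((isBdd_const _).mul ((isBdd_const _).sub (isBdd_freq n a)).abs)
      fun y => by positivity
  refine le_trans ?_ (tsum_ofReal_le_Lam (expect_abs_sub_freq_le_mass hA.stationary hn)
    (expect_abs_sub_freq_le_sqrt hA hn))
  simp only [e]
  rw [ENNReal.tsum_comm, ofReal_expect _ (isBdd_empDeviation n _) fun _ => ENNReal.toReal_nonneg]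
  refine ENNReal.tsum_le_tsum fun y => ?_
  rw [ENNReal.tsum_mul_left, ENNReal.ofReal_toReal (empDeviation_ne_top _ y)]
  exact mul_le_mul_right (empDeviation_le_tsum hn _ y) _

end

section

variable {A B : ℕ → PMF ℕ} {π : PMF ℕ} {G θ : ℝ}

lemma obsLaw_succ_apply (n : ℕ) (μ : PMF ℕ) (y : Fin (n + 1) → ℕ) :
    obsLaw A B (n + 1) μ y =
      ∑' x, μ x * (B x (y 0) * obsLaw A B n (A x) (Fin.tail y)) := by
  rw [obsLaw, PMF.bind_apply]
  refine tsum_congr fun x => ?_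
  rw [PMF.bind_apply, tsum_eq_single (y 0), PMF.map_apply, tsum_eq_single (Fin.tail y)]
  · rw [if_pos (Fin.cons_self_tail y).symm]
  · intro z hz
    rw [if_neg]
    rintro h
    exact hz (by rw [h, Fin.tail_cons])
  · intro b hb
    rw [PMF.map_apply, ENNReal.tsum_eq_zero.2, mul_zero]
    intro z
    rw [if_neg]
    rintro h
    exact hb (by rw [h, Fin.cons_zero])

lemma obsProb_succ (n : ℕ) (p : PMF ℕ) (y : Fin (n + 2) → ℕ) :
    obsProb p A B y = ∑' x, p x * (B x (y 0) * obsProb (A x) A B (Fin.tail y)) := by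
  rw [obsProb, ← (Fin.consEquiv fun _ => ℕ).tsum_eq, ENNReal.tsum_prod']
  refine tsum_congr fun x => ?_
  rw [obsProb, ← ENNReal.tsum_mul_left, ← ENNReal.tsum_mul_left]
  refine tsum_congr fun z => ?_
  simp only [pathProb, Fin.consEquiv_apply, Fin.prod_univ_succ (n := n + 1), Fin.cons_zero,
    Fin.cons_succ, Fin.tail]
  rw [Fin.prod_univ_succ]
  simp only [Fin.castSucc_zero, Fin.cons_zero, Fin.cons_succ, ← Fin.succ_castSucc]
  ring

lemma obsLaw_apply (n : ℕ) (μ : PMF ℕ) (y : Fin (n + 1) → ℕ) :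
    obsLaw A B (n + 1) μ y = obsProb μ A B y := by
  induction n generalizing μ with
  | zero =>
    rw [obsLaw_succ_apply, obsProb, ← (Equiv.funUnique (Fin 1) ℕ).symm.tsum_eq]
    refine tsum_congr fun x => ?_
    have h : Fin.tail y = Fin.elim0 := Subsingleton.elim _ _
    simp [obsLaw, pathProb, h]
  | succ n ih =>
    rw [obsLaw_succ_apply, obsProb_succ]
    simp only [ih]

lemma obsProb_pure (p : PMF ℕ) {n : ℕ} (y : Fin (n + 1) → ℕ) :
    obsProb p A PMF.pure y = pathProb p A y := by
  rw [obsProb, tsum_eq_single y]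
  · simp
  · intro x hx
    obtain ⟨i, hi⟩ := Function.ne_iff.1 hx
    rw [Finset.prod_eq_zero (Finset.mem_univ i)
      (show PMF.pure (x i) (y i) = 0 from PMF.pure_apply_of_ne _ _ hi.symm), mul_zero]

lemma IsMarkovChain.isHiddenMarkovChain {Ω : Type*} [MeasurableSpace Ω] {P : Measure Ω}
    {Y : ℕ → Ω → ℕ} (h : IsMarkovChain P Y π A) : IsHiddenMarkovChain P Y π A PMF.pure :=
  ⟨h.measurable, fun n y => by rw [h.law, obsProb_pure]⟩

lemma IsHiddenMarkovChain.map_eq {Ω : Type*} [MeasurableSpace Ω] {P : Measure Ω}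
    {Y : ℕ → Ω → ℕ} (h : IsHiddenMarkovChain P Y π A B) (n : ℕ) :
    P.map (fun ω (i : Fin (n + 1)) => Y i ω) = (obsLaw A B (n + 1) π).toMeasure := by
  have hm : Measurable fun ω (i : Fin (n + 1)) => Y i ω := measurable_pi_lambda _ fun i =>
    h.measurable i
  refine Measure.ext_of_singleton fun y => ?_
  rw [Measure.map_apply hm (measurableSet_singleton y), PMF.toMeasure_apply_singleton _ _
    (measurableSet_singleton y), obsLaw_apply, ← h.law]
  congr 1
  ext ω
  simp [funext_iff]

lemma expect_obsLaw_le_add (hA : GeometricallyErgodic A π G θ) {c : ℝ} (hc : 0 ≤ c) {n : ℕ}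
    {g : (Fin n → ℕ) → ℝ} (hb : IsBdd g) (hg : HasBddDiff c g) (x x' : ℕ) :
    expect (obsLaw A B n (A x)) g ≤
      expect (obsLaw A B n (A x')) g + c * (2 * (G * (θ / (1 - θ)))) := by
  have h := expect_obsLaw_sub_le (A := A) (B := B) hb hg (A x) (A x')
  have h2 : ∑ j ∈ Finset.range n, tvDist ((fun p : PMF ℕ => p.bind A)^[j] (A x))
      ((fun p : PMF ℕ => p.bind A)^[j] (A x')) ≤ 2 * (G * (θ / (1 - θ))) := by
    refine le_trans (Finset.sum_le_sum fun j _ => (tvDist_triangle _ _ π).trans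
      (add_le_add (hA.tvDist_le x j) (hA.tvDist_le x' j))) ?_
    simp only [← two_mul]
    rw [← Finset.mul_sum, ← Finset.mul_sum]
    exact mul_le_mul_of_nonneg_left (mul_le_mul_of_nonneg_left
      (sum_range_pow_succ_le hA.theta_nonneg hA.theta_lt_one n)
      (zero_le_one.trans hA.one_le_G)) zero_le_two
  linarith [mul_le_mul_of_nonneg_left h2 hc]

/-- McDiarmid's inequality for the observations of a geometrically ergodic hidden Markov chain. -/
lemma toMeasure_obsLaw_deviation_le (hA : GeometricallyErgodic A π G θ) {n : ℕ} (hn : 1 ≤ n)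
    {f : (Fin n → ℕ) → ℝ} (hb : IsBdd f) (hf : HasBddDiff (1 / n) f) (μ : PMF ℕ) {ε : ℝ}
    (hε : 0 < ε) :
    (obsLaw A B n μ).toMeasure.real {y | expect (obsLaw A B n μ) f + ε < f y} ≤
      Real.exp (-(n * (1 - θ) ^ 2 * ε ^ 2 / (2 * G ^ 2))) := by
  have hn' : (0 : ℝ) < n := by positivity
  have hθ : 0 < 1 - θ := sub_pos.2 hA.theta_lt_one
  have hθ0 := hA.theta_nonneg
  have hG : 0 < G := zero_lt_one.trans_le hA.one_le_G
  set m := expect (obsLaw A B n μ) f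
  set s : ℝ := G / (n * (1 - θ)) with hs
  have hs0 : 0 < s := by positivity
  set t : ℝ := ε / (n * s ^ 2) with ht
  have ht0 : 0 < t := by positivity
  have hbe : IsBdd fun y => Real.exp (t * (f y - m)) :=
    ((isBdd_const t).mul (hb.sub (isBdd_const _))).exp
  have hmgf := expect_exp_obsLaw_le (A := A) (B := B) (c := 1 / n)
    (fun k g hg hg' => expect_obsLaw_le_add hA (by positivity) hg hg') t hb hf μ
  have hcR : (1 / (n : ℝ) + 1 / n * (2 * (G * (θ / (1 - θ))))) / 2 ≤ s := by
    have e : (1 / (n : ℝ) + 1 / n * (2 * (G * (θ / (1 - θ))))) / 2 =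
        ((1 - θ) + 2 * G * θ) / 2 / (n * (1 - θ)) := by
      field_simp
    rw [e, hs]
    gcongr
    nlinarith [hA.one_le_G]
  have hcR0 : 0 ≤ (1 / (n : ℝ) + 1 / n * (2 * (G * (θ / (1 - θ))))) / 2 := by positivity
  rw [toMeasure_real_eq_expect]
  refine (expect_mono _ (.of_mem_Icc (indicator_one_mem _)) ((isBdd_const (Real.exp (-(t * ε)))).mul
    hbe) fun y => ?_).trans ?_
  · by_cases hy : m + ε < f y
    · rw [Set.indicator_of_mem (by exact hy), ← Real.exp_add]
      refine Real.one_le_exp ?_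
      nlinarith
    · rw [Set.indicator_of_notMem (by exact hy)]
      positivity
  · rw [expect_const_mul]
    refine (mul_le_mul_of_nonneg_left hmgf (Real.exp_pos _).le).trans ?_
    rw [← Real.exp_add]
    refine Real.exp_le_exp.2 ?_
    have h1 : (n : ℝ) * (((1 / (n : ℝ) + 1 / n * (2 * (G * (θ / (1 - θ))))) / 2) ^ 2 * t ^ 2 / 2) ≤
        n * (s ^ 2 * t ^ 2 / 2) := by gcongr
    have h2 : -(t * ε) + n * (s ^ 2 * t ^ 2 / 2) =
        -(n * (1 - θ) ^ 2 * ε ^ 2 / (2 * G ^ 2)) := by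
      rw [ht, hs]
      field_simp
      ring
    linarith

lemma IsHiddenMarkovChain.uniformDeviation_le {Ω : Type*} [MeasurableSpace Ω] {P : Measure Ω}
    [IsProbabilityMeasure P] {Y : ℕ → Ω → ℕ} (h : IsHiddenMarkovChain P Y π A B)
    (hA : GeometricallyErgodic A π G θ) {n : ℕ} (hn : 1 ≤ n) {ε : ℝ} (hε : 0 < ε) :
    P.real {ω | Lam G θ n (π.bind B) + ENNReal.ofReal ε < uniformDeviation (π.bind B) Y n ω} ≤
      Real.exp (-(n * (1 - θ) ^ 2 * ε ^ 2 / (2 * G ^ 2))) := by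
  set ρ := π.bind B
  set m := expect (obsLaw A B n π) fun y => (empDeviation ρ y).toReal with hm
  have hmap : P.map (fun ω (i : Fin n) => Y i ω) = (obsLaw A B n π).toMeasure := by
    obtain ⟨k, rfl⟩ := Nat.exists_eq_add_of_le' hn
    exact h.map_eq k
  have hZ : Measurable fun ω (i : Fin n) => Y i ω := measurable_pi_lambda _ fun i =>
    h.measurable i
  refine le_trans ?_ (toMeasure_obsLaw_deviation_le (B := B) hA hn (isBdd_empDeviation n ρ)
    (hasBddDiff_empDeviation n ρ) π hε)
  rw [← hmap, map_measureReal_apply hZ .of_discrete]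
  refine measureReal_mono fun ω hω => ?_
  rw [Set.mem_ofPred_eq, uniformDeviation_eq] at hω
  have h1 := (add_le_add_left (ofReal_expect_empDeviation_le hA hn) (ENNReal.ofReal ε)).trans_lt hω
  have hm0 : 0 ≤ m := (expect_mem_Icc (M := 1) _ fun y => ⟨ENNReal.toReal_nonneg,
    ENNReal.toReal_le_of_le_ofReal zero_le_one (by simpa using empDeviation_le_one ρ y)⟩).1
  rw [← ENNReal.ofReal_add hm0 hε.le, ENNReal.ofReal_lt_iff_lt_toReal (by positivity)
    (empDeviation_ne_top _ _)] at h1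
  exact h1

lemma tendsto_Lam (hG : 1 ≤ G) (hθ0 : 0 ≤ θ) (hθ1 : θ < 1) (ρ : PMF ℕ) :
    Tendsto (fun n : ℕ => Lam G θ n ρ) atTop (𝓝 0) := by
  have hθ : 0 < 1 - θ := sub_pos.2 hθ1
  set C : ℝ := 1 / 2 * √((1 + 2 * G * θ) / (1 - θ)) with hC
  set δ : ℕ → ℝ≥0∞ := fun n => (1 / (n : ℝ≥0∞)) ^ (1 / 2 : ℝ) with hδ
  set u : ℕ → ℕ → ℝ≥0∞ := fun n a =>
    if 1 / (n : ℝ≥0∞) ≤ ρ a then δ n * (ρ a) ^ (1 / 2 : ℝ) else ρ a with hu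
  have hsq : ∀ x : ℝ≥0∞, x ^ (1 / 2 : ℝ) * x ^ (1 / 2 : ℝ) = x := fun x => by
    rw [← ENNReal.rpow_add_of_nonneg _ _ (by norm_num) (by norm_num)]
    norm_num
  have huρ : ∀ n a, u n a ≤ ρ a := fun n a => by
    simp only [hu]
    split_ifs with h
    · refine le_trans ?_ (hsq (ρ a)).le
      exact mul_le_mul_left (ENNReal.rpow_le_rpow h (by norm_num)) _
    · exact le_rfl
  have huδ : ∀ n a, u n a ≤ δ n := fun n a => by
    have h1 : (ρ a) ^ (1 / 2 : ℝ) ≤ 1 :=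
      ENNReal.rpow_le_one (ρ.coe_le_one a) (by norm_num)
    simp only [hu]
    split_ifs with h
    · exact mul_le_of_le_one_right' h1
    · rw [← hsq (ρ a)]
      exact (mul_le_of_le_one_right' h1).trans
        (ENNReal.rpow_le_rpow (not_le.1 h).le (by norm_num))
  have hδ0 : Tendsto δ atTop (𝓝 0) := by
    have := (ENNReal.continuous_rpow_const (y := 1 / 2)).tendsto 0 |>.comp
      ENNReal.tendsto_inv_nat_nhds_zero
    simpa [hδ, Function.comp_def] using this
  have hsum : Tendsto (fun n => ∑' a, u n a) atTop (𝓝 0) := by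
    have := tendsto_lintegral_of_dominated_convergence (μ := Measure.count) (F := u)
      (f := fun _ => 0) ρ (fun n => .of_discrete) (fun n => ae_of_all _ (huρ n))
      (by simp [lintegral_count, ρ.tsum_coe]) (ae_of_all _ fun a =>
        tendsto_of_tendsto_of_tendsto_of_le_of_le tendsto_const_nhds hδ0 (fun _ => zero_le)
          fun n => huδ n a)
    simpa [lintegral_count] using this
  have hlim : Tendsto (fun n => (ENNReal.ofReal C + 1) * ∑' a, u n a) atTop (𝓝 0) := by
    simpa using ENNReal.Tendsto.const_mul hsum
      (Or.inr (ENNReal.add_ne_top.2 ⟨ENNReal.ofReal_ne_top, ENNReal.one_ne_top⟩))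
  refine tendsto_of_tendsto_of_tendsto_of_le_of_le' tendsto_const_nhds hlim
    (Eventually.of_forall fun _ => zero_le) ?_
  filter_upwards [eventually_ge_atTop 1] with n hn
  have hn' : (0 : ℝ) < n := by positivity
  have hγ : ENNReal.ofReal (gammaCoeff G θ n) = ENNReal.ofReal C * δ n := by
    have e : gammaCoeff G θ n = C * (1 / (n : ℝ)) ^ (1 / 2 : ℝ) := by
      rw [gammaCoeff, hC, ← Real.sqrt_eq_rpow, mul_assoc (1 / 2 : ℝ) (√_),
        ← Real.sqrt_mul (by positivity)]
      congr 2
      field_simp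
    rw [e, ENNReal.ofReal_mul (by positivity),
      ← ENNReal.ofReal_rpow_of_nonneg (by positivity) (by norm_num),
      ENNReal.ofReal_div_of_pos hn', ENNReal.ofReal_one, ENNReal.ofReal_natCast]
  have h1 : ∑' a : {a // 1 / (n : ℝ≥0∞) ≤ ρ a}, δ n * (ρ a) ^ (1 / 2 : ℝ) =
      ∑' a : {a // 1 / (n : ℝ≥0∞) ≤ ρ a}, u n a :=
    tsum_congr fun a => (if_pos a.2).symm
  have h2 : ∑' a : {a // ρ a < 1 / (n : ℝ≥0∞)}, ρ a =
      ∑' a : {a // ρ a < 1 / (n : ℝ≥0∞)}, u n a :=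
    tsum_congr fun a => (if_neg (not_le.2 a.2)).symm
  have h3 := tsum_subtype_le_add_tsum_subtype_lt ρ (u n) (1 / (n : ℝ≥0∞))
  rw [Lam, hγ, mul_assoc, ← ENNReal.tsum_mul_left, h1, add_mul, one_mul]
  refine add_le_add ?_ ((min_le_right _ _).trans ?_)
  · rw [← h3]
    exact mul_le_mul_right le_self_add _
  · rw [h2, ← h3]
    exact le_add_self

end

end UniformChernoff

end

theorem theorem3 (G θ : ℝ) (hG : 1 ≤ G) (hθ0 : 0 ≤ θ) (hθ1 : θ < 1) :
    (∀ ρ : PMF ℕ, Tendsto (fun n : ℕ => UniformChernoff.Lam G θ n ρ) atTop (𝓝 0)) ∧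
    (∀ {Ω : Type*} [MeasurableSpace Ω] (P : Measure Ω) [IsProbabilityMeasure P]
        (π : PMF ℕ) (A : ℕ → PMF ℕ), UniformChernoff.GeometricallyErgodic A π G θ →
      -- Markov chains
      (∀ Y : ℕ → Ω → ℕ, UniformChernoff.IsMarkovChain P Y π A →
        ∀ n : ℕ, 1 ≤ n → ∀ ε : ℝ, 0 < ε →
          P.real {ω | UniformChernoff.Lam G θ n π + ENNReal.ofReal ε <
              UniformChernoff.uniformDeviation π Y n ω} ≤
            Real.exp (-(n * (1 - θ) ^ 2 * ε ^ 2 / (2 * G ^ 2)))) ∧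
      -- hidden Markov chains
      (∀ (B : ℕ → PMF ℕ) (Y : ℕ → Ω → ℕ), UniformChernoff.IsHiddenMarkovChain P Y π A B →
        ∀ n : ℕ, 1 ≤ n → ∀ ε : ℝ, 0 < ε →
          P.real {ω | UniformChernoff.Lam G θ n (π.bind B) + ENNReal.ofReal ε <
              UniformChernoff.uniformDeviation (π.bind B) Y n ω} ≤
            Real.exp (-(n * (1 - θ) ^ 2 * ε ^ 2 / (2 * G ^ 2))))) := by
  refine ⟨UniformChernoff.tendsto_Lam hG hθ0 hθ1, fun P _ π A hA => ⟨fun Y hY n hn ε hε => ?_,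
    fun B Y hY n hn ε hε => hY.uniformDeviation_le hA hn hε⟩⟩
  simpa only [PMF.bind_pure] using hY.isHiddenMarkovChain.uniformDeviation_le hA hn hε
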